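/- \textbf{Proposition.} The \emph{Avoider-Enforcer game} on a finite graph $G$ (finite, simple, undirected) is played by two players, Avoider and Enforcer, who take turns picking a vertex of $G$ that has not been picked yet, until all the vertices have been picked. Enforcer wins if Avoider has picked both ends of some edge of $G$; otherwise Avoider wins. Avoider \emph{wins on $G$ as second-to-last player} if she has a winning strategy when the first player is chosen so that Enforcer is the last player, i.e. when Avoider moves first if $|V(G)|$ is even and Enforcer moves first if $|V(G)|$ is odd. $P_n$ and $C_n$ denote the path and the cycle on $n$ vertices, and $2P_3$ denotes two vertex-disjoint copies of $P_3$. The \emph{bull} is the graph obtained from a triangle by adding a pendent edge at two of its vertices, and the \emph{3-sunlet} is the graph obtained from a triangle by adding a pendent edge at each of its three vertices (the pendent edges having distinct new end vertices). A \emph{pseudo-star} is a connected graph with at least three vertices that contains a vertex $y$ such that, after the deletion of $y$, every connected component has one or two vertices. Let $G$ be a finite graph. The following three assertions are equivalent: \begin{enumerate} \item[(1)] Avoider wins on $G$ as second-to-last player. \item[(2)] Every connected component of $G$ is $P_1$ or $P_2$ (up to isomorphism), except for at most one, which is either $C_5$, the bull (up to isomorphism) or a pseudo-star. \item[(3)]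 $G$ does not contain $2P_3$, $C_4$ or the 3-sunlet as a (not necessarily induced) subgraph. \end{enumerate} -/

import Mathlib

namespace AvoiderEnforcer

/-- The two players of an Avoider-Enforcer game. -/
inductive Player
  | avoider
  | enforcer

/-- The opponent of a player. -/
def Player.opponent : Player → Player
  | .avoider => .enforcer
  | .enforcer => .avoider

/-- The Avoider-Enforcer game on the hypergraph with vertex set `V` and edge set `edges`.
`AvoiderWinsFrom edges p A E` says that Avoider has a winning strategy from the position in which
Avoider has picked the vertices of `A`, Enforcer has picked the vertices of `E`, and it is the
turn of the player `p`. Players alternately pick an unpicked vertex until all the vertices have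
been picked, and Avoider wins if and only if she has then not picked all the vertices of some edge.
A proof of this predicate is exactly a winning strategy tree: it provides one move whenever it is
Avoider's turn, and an answer to all the legal moves whenever it is Enforcer's turn. -/
inductive AvoiderWinsFrom {V : Type*} [Fintype V] [DecidableEq V] (edges : Set (Finset V)) :
    Player → Finset V → Finset V → Prop
  | gameOver (p : Player) (A E : Finset V) (hfull : A ∪ E = Finset.univ)
      (hA : ∀ e ∈ edges, ¬ e ⊆ A) : AvoiderWinsFrom edges p A E
  | avoiderMove (A E : Finset V) (x : V) (hx : x ∉ A ∪ E)
      (h : AvoiderWinsFrom edges .enforcer (insert x A) E) :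
      AvoiderWinsFrom edges .avoider A E
  | enforcerMove (A E : Finset V) (hfree : A ∪ E ≠ Finset.univ)
      (h : ∀ y : V, y ∉ A ∪ E → AvoiderWinsFrom edges .avoider A (insert y E)) :
      AvoiderWinsFrom edges .enforcer A E

/-- The player who moves first on the vertex set `V` if `last` is to be the last player: the last
player is the first player if the number of vertices is odd, and the second player if it is even. -/
def firstPlayer (V : Type*) [Fintype V] (last : Player) : Player :=
  if Odd (Fintype.card V) then last else last.opponent

/-- Avoider wins as second-to-last player, that is, when Enforcer is the last player. -/
def AvoiderWinsAsSecondToLast {V : Type*} [Fintype V] [DecidableEq V]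
    (edges : Set (Finset V)) : Prop :=
  AvoiderWinsFrom edges (firstPlayer V .enforcer) ∅ ∅

/-- The edges of a graph, as a 2-uniform hypergraph on the same vertex set. -/
def graphEdges {V : Type*} [DecidableEq V] (G : SimpleGraph V) : Set (Finset V) :=
  {e | ∃ u v : V, G.Adj u v ∧ e = {u, v}}

/-- The bull: a triangle `0 1 2` with pendent edges at `0` and `1`. -/
def bull : SimpleGraph (Fin 5) :=
  SimpleGraph.fromEdgeSet {s(0, 1), s(1, 2), s(0, 2), s(0, 3), s(1, 4)}

/-- The 3-sunlet: a triangle `0 1 2` with a pendent edge at each of its vertices. -/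
def sunlet3 : SimpleGraph (Fin 6) :=
  SimpleGraph.fromEdgeSet {s(0, 1), s(1, 2), s(0, 2), s(0, 3), s(1, 4), s(2, 5)}

/-- The graph `2P₃`: two vertex-disjoint copies of the path on three vertices. -/
def twoP3 : SimpleGraph (Fin 3 ⊕ Fin 3) :=
  SimpleGraph.sum (SimpleGraph.pathGraph 3) (SimpleGraph.pathGraph 3)

/-- A pseudo-star: a connected graph with at least three vertices that has a vertex `y` such that,
after the deletion of `y`, all the connected components have one or two vertices. -/
def IsPseudoStar {W : Type*} (G : SimpleGraph W) : Prop :=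
  G.Connected ∧ 3 ≤ Nat.card W ∧
    ∃ y : W, ∀ K : (G.induce ({y}ᶜ : Set W)).ConnectedComponent,
      K.supp.ncard = 1 ∨ K.supp.ncard = 2

/-- The graph is (isomorphic to) `P₁` or `P₂`. -/
def IsP1OrP2 {W : Type*} (G : SimpleGraph W) : Prop :=
  Nonempty (G ≃g SimpleGraph.pathGraph 1) ∨ Nonempty (G ≃g SimpleGraph.pathGraph 2)

/-- The graph is (isomorphic to) `C₅` or the bull, or is a pseudo-star. -/
def IsC5OrBullOrPseudoStar {W : Type*} (G : SimpleGraph W) : Prop :=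
  Nonempty (G ≃g SimpleGraph.cycleGraph 5) ∨ Nonempty (G ≃g bull) ∨ IsPseudoStar G

end AvoiderEnforcer

namespace AvoiderEnforcer

/-! ### Enforcer's strategies -/

/-! Everything is governed by the paths on three vertices, induced or not (`IsP3`).

(1) implies (3). Suppose that a copy of a graph `H` of even order sits in `G`. Enforcer can arrange
that, at Avoider's turns, both the copy and its complement have an even number of free vertices, and
can then always answer in the part where Avoider has just moved. A win of Avoider on `G` thus
restricts to a win on `H` (`AvoiderWinsAsSecondToLast.of_isContained`). The three forbidden graphs
have even order, and a finite search shows that Enforcer wins on each.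

(3) implies (2). Without `2P₃`, any two paths on three vertices meet, so at most one component has
more than two vertices. By `iso_or_exists_hitting`, such a component is `C₅`, the bull, or has a
vertex hitting all its paths on three vertices. The last case is exactly that of a pseudo-star
(`isPseudoStar_iff`).

(2) implies (1). A graph without paths on three vertices is a matching plus isolated vertices, so if
its order is odd it has an isolated vertex (`exists_isolated_of_odd`). If `y` hits all the paths,
Avoider never takes `y`: an even number of vertices is free at her turn, so an odd number remains
besides `y`, and one of these is isolated among them. If the large component is `C₅` or the bull,
its order is odd, so Avoider can play isolated vertices outside it until Enforcer enters it; one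
vertex then hits all the remaining paths. -/

/-- As long as Avoider can still win, she has not picked all the vertices of an edge. -/
theorem AvoiderWinsFrom.not_subset {V : Type*} [Fintype V] [DecidableEq V]
    {edges : Set (Finset V)} {p : Player} {A E : Finset V}
    (h : AvoiderWinsFrom edges p A E) : ∀ e ∈ edges, ¬ e ⊆ A := by
  induction h with
  | gameOver p A E hfull hA => exact hA
  | avoiderMove A E x hx h ih =>
    exact fun e he hs => ih e he (hs.trans (Finset.subset_insert _ _))
  | enforcerMove A E hfree h ih =>
    obtain ⟨y, hy⟩ : ∃ y, y ∉ A ∪ E := by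
      by_contra! hc
      exact hfree (Finset.eq_univ_iff_forall.2 hc)
    exact ih y hy

/-- A free vertex is required because `gameOver` applies whoever is to move. -/
theorem avoiderWinsFrom_avoider_iff {V : Type*} [Fintype V] [DecidableEq V]
    {edges : Set (Finset V)} {A E : Finset V} (hfree : A ∪ E ≠ Finset.univ) :
    AvoiderWinsFrom edges .avoider A E ↔
      ∃ x, x ∉ A ∪ E ∧ AvoiderWinsFrom edges .enforcer (insert x A) E := by
  constructor
  · intro h
    cases h with
    | gameOver _ _ _ hfull _ => exact absurd hfull hfree
    | avoiderMove _ _ x hx h => exact ⟨x, hx, h⟩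
  · rintro ⟨x, hx, h⟩
    exact .avoiderMove A E x hx h

theorem AvoiderWinsFrom.enforcer_move {V : Type*} [Fintype V] [DecidableEq V]
    {edges : Set (Finset V)} {A E : Finset V} (h : AvoiderWinsFrom edges .enforcer A E)
    {y : V} (hy : y ∉ A ∪ E) : AvoiderWinsFrom edges .avoider A (insert y E) := by
  cases h with
  | gameOver _ _ _ hfull _ => exact absurd (hfull ▸ Finset.mem_univ y) hy
  | enforcerMove _ _ _ h => exact h y hy

/-- Enforcer can answer each move in the same part of the board, if both the copy of `H` and its
complement have an even number of free vertices when it is Avoider's turn. -/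
theorem AvoiderWinsFrom.comap {V W : Type*} [Fintype V] [DecidableEq V] [Fintype W]
    [DecidableEq W] {G : SimpleGraph V} {H : SimpleGraph W} (f : W → V)
    (hf : Function.Injective f) (hadj : ∀ u v, H.Adj u v → G.Adj (f u) (f v)) (n : ℕ) :
    ∀ A E : Finset V, (A ∪ E)ᶜ.card = n →
      Even ((A ∪ E)ᶜ \ Finset.univ.image f).card →
      Even ((A ∪ E)ᶜ ∩ Finset.univ.image f).card →
      AvoiderWinsFrom (graphEdges G) .avoider A E →
      AvoiderWinsFrom (graphEdges H) .avoider
        (A.preimage f hf.injOn) (E.preimage f hf.injOn) := by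
  induction n using Nat.strong_induction_on with
  | _ n ih =>
  intro A E hn hout hin hwin
  by_cases hfull : A ∪ E = Finset.univ
  · refine .gameOver _ _ _ ?_ ?_
    · rw [Finset.eq_univ_iff_forall] at hfull ⊢
      intro w
      simpa using hfull (f w)
    · rintro e ⟨u, v, huv, rfl⟩ hs
      refine hwin.not_subset _ ⟨f u, f v, hadj u v huv, rfl⟩ ?_
      simp only [Finset.insert_subset_iff, Finset.singleton_subset_iff, Finset.mem_preimage]
        at hs ⊢
      exact hs
  -- Avoider's move `x` is read off from her strategy on `G`. Inside the copy it is also her move on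
  -- `H`, and each answer of Enforcer on `H` is relayed to `G`.
  obtain ⟨x, hx, hE⟩ := (avoiderWinsFrom_avoider_iff hfull).1 hwin
  have key : ∀ z, z ∉ insert x A ∪ E →
      (insert x A ∪ insert z E)ᶜ = ((A ∪ E)ᶜ.erase x).erase z := by
    intro z _
    ext t
    simp only [Finset.mem_compl, Finset.mem_union, Finset.mem_insert, Finset.mem_erase]
    tauto
  have hcard : ∀ z, z ∉ insert x A ∪ E → (insert x A ∪ insert z E)ᶜ.card < n := by
    intro z hz
    rw [key z hz, ← hn]
    refine lt_of_le_of_lt (Finset.card_le_card (Finset.erase_subset _ _)) ?_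
    exact Finset.card_erase_lt_of_mem (by simpa using hx)
  have two : ∀ (P : Finset V) (z : V), x ∈ P → z ∈ P → z ≠ x → Even P.card →
      Even ((P.erase x).erase z).card := by
    intro P z hxP hzP hzx hP
    have h1 := Finset.card_erase_add_one hxP
    have h2 := Finset.card_erase_add_one (Finset.mem_erase.2 ⟨hzx, hzP⟩)
    rw [← h1, ← h2] at hP
    simpa [Nat.even_add_one] using hP
  have one : ∀ P : Finset V, x ∈ P → Even P.card → ∃ z ∈ P, z ≠ x := by
    intro P hxP hP
    have h1 := Finset.card_erase_add_one hxP
    have : (P.erase x).card ≠ 0 := by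
      intro h0
      rw [← h1, h0] at hP
      simp at hP
    obtain ⟨z, hz⟩ := Finset.card_pos.1 (Nat.pos_of_ne_zero this)
    exact ⟨z, (Finset.mem_erase.1 hz).2, (Finset.mem_erase.1 hz).1⟩
  by_cases hxf : x ∈ Finset.univ.image f
  · obtain ⟨w, -, rfl⟩ := Finset.mem_image.1 hxf
    have hins : (insert (f w) A).preimage f hf.injOn = insert w (A.preimage f hf.injOn) := by
      ext t; simp [hf.eq_iff]
    refine .avoiderMove _ _ w (by simpa using hx) ?_
    rw [← hins]
    refine .enforcerMove _ _ ?_ ?_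
    -- By parity another vertex of the copy is free, so the game on `H` is not over.
    · obtain ⟨z, hz, hzx⟩ := one _ (Finset.mem_inter.2 ⟨by simpa using hx, hxf⟩) hin
      obtain ⟨hz1, hz2⟩ := Finset.mem_inter.1 hz
      obtain ⟨t, -, rfl⟩ := Finset.mem_image.1 hz2
      intro hu
      have := hu ▸ Finset.mem_univ t
      simp only [Finset.mem_union, Finset.mem_preimage, Finset.mem_insert] at this
      simp only [Finset.mem_compl, Finset.mem_union] at hz1
      tauto
    · intro t ht
      have ht' : f t ∉ insert (f w) A ∪ E := by simpa [and_assoc] using ht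
      have hins2 : (insert (f t) E).preimage f hf.injOn = insert t (E.preimage f hf.injOn) := by
        ext s; simp [hf.eq_iff]
      rw [← hins2]
      have htx : f t ≠ f w := by rintro h; simp [h] at ht'
      have htF : f t ∈ (A ∪ E)ᶜ := by
        simp only [Finset.mem_compl, Finset.mem_union, Finset.mem_insert] at ht' ⊢
        tauto
      refine ih _ (hcard _ ht') _ _ rfl ?_ ?_ (hE.enforcer_move ht')
      · rw [key _ ht']
        convert hout using 2
        ext s
        simp only [Finset.mem_sdiff, Finset.mem_erase, Finset.mem_image, Finset.mem_univ,
          true_and]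
        constructor
        · tauto
        · rintro ⟨h1, h2⟩
          exact ⟨⟨fun h => h2 ⟨t, h.symm⟩, fun h => h2 ⟨w, h.symm⟩, h1⟩, h2⟩
      · rw [key _ ht', Finset.erase_inter, Finset.erase_inter]
        exact two _ _ (Finset.mem_inter.2 ⟨by simpa using hx, hxf⟩)
          (Finset.mem_inter.2 ⟨htF, by simp⟩) htx hin
  -- By parity Enforcer can also answer outside the copy. The position on `H` does not change, which
  -- is why the induction counts the free vertices of `G`.
  · have hxo : x ∈ (A ∪ E)ᶜ \ Finset.univ.image f :=
      Finset.mem_sdiff.2 ⟨by simpa using hx, hxf⟩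
    obtain ⟨z, hz, hzx⟩ := one _ hxo hout
    obtain ⟨hz1, hz2⟩ := Finset.mem_sdiff.1 hz
    have hz' : z ∉ insert x A ∪ E := by
      simp only [Finset.mem_compl, Finset.mem_union, Finset.mem_insert] at hz1 ⊢
      tauto
    have hne : ∀ {u : V}, u ∉ Finset.univ.image f → ∀ t, f t ≠ u := by
      rintro u hu t rfl
      simp at hu
    have := ih _ (hcard _ hz') _ _ rfl ?_ ?_ (hE.enforcer_move hz')
    · convert this using 1
      · ext t; simp [hne hxf]
      · ext t; simp [hne hz2]
    · rw [key _ hz', Finset.erase_sdiff_comm, Finset.erase_sdiff_comm]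
      exact two _ _ hxo hz hzx hout
    · rw [key _ hz']
      convert hin using 2
      ext s
      simp only [Finset.mem_inter, Finset.mem_erase]
      constructor
      · tauto
      · rintro ⟨h1, h2⟩
        exact ⟨⟨fun h => hz2 (h ▸ h2), fun h => hxf (h ▸ h2), h1⟩, h2⟩

/-- If Avoider wins on `G` as second-to-last player, then she does so on each subgraph with an even
number of vertices. -/
theorem AvoiderWinsAsSecondToLast.of_isContained {V W : Type*} [Fintype V] [DecidableEq V]
    [Fintype W] [DecidableEq W] {G : SimpleGraph V} {H : SimpleGraph W}
    (hHG : H.IsContained G) (hW : Even (Fintype.card W))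
    (h : AvoiderWinsAsSecondToLast (graphEdges G)) :
    AvoiderWinsFrom (graphEdges H) .avoider ∅ ∅ := by
  obtain ⟨φ⟩ := hHG
  have hf : Function.Injective φ := φ.injective
  have hadj : ∀ u v, H.Adj u v → G.Adj (φ u) (φ v) := fun u v huv => φ.toHom.map_adj huv
  have hR : (Finset.univ.image φ).card = Fintype.card W := by
    rw [Finset.card_image_of_injective _ hf, Finset.card_univ]
  have hsum := Finset.card_sdiff_add_card_inter (Finset.univ : Finset V) (Finset.univ.image φ)
  rw [Finset.univ_inter, hR, Finset.card_univ] at hsum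
  unfold AvoiderWinsAsSecondToLast firstPlayer at h
  split_ifs at h with hodd
  -- Here Enforcer opens the game, and an opening move outside the copy makes the complement even.
  · have ho : Odd (Finset.univ \ Finset.univ.image φ).card := by
      rw [← hsum, Nat.odd_add] at hodd
      exact hodd.2 hW
    obtain ⟨z, hz⟩ := Finset.card_pos.1 ho.pos
    have hz2 := (Finset.mem_sdiff.1 hz).2
    have hne : ∀ t, φ t ≠ z := by
      rintro t rfl
      simp at hz2
    have := AvoiderWinsFrom.comap φ hf hadj _ ∅ (insert z ∅) rfl ?_ ?_
      (h.enforcer_move (y := z) (by simp))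
    · convert this using 1
      · simp
      · ext t; simp [hne]
    · have h1 : (∅ ∪ insert z ∅ : Finset V)ᶜ \ Finset.univ.image φ =
          (Finset.univ \ Finset.univ.image φ).erase z := by
        ext t; simp
      rw [h1, Finset.card_erase_of_mem hz]
      exact Nat.Odd.sub_odd ho odd_one
    · have h1 : (∅ ∪ insert z ∅ : Finset V)ᶜ ∩ Finset.univ.image φ = Finset.univ.image φ := by
        refine Finset.inter_eq_right.2 fun t ht => ?_
        simp only [Finset.empty_union, insert_empty_eq, Finset.mem_compl, Finset.mem_singleton]
        rintro rfl
        exact hz2 ht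
      rwa [h1, hR]
  · have he : Even (Finset.univ \ Finset.univ.image φ).card := by
      rw [← hsum, Nat.not_odd_iff_even, Nat.even_add] at hodd
      exact hodd.2 hW
    have := AvoiderWinsFrom.comap φ hf hadj _ ∅ ∅ rfl (by simpa using he)
      (by simpa [hR] using hW) h
    simpa using this

/-! ### Exhaustive search on the three forbidden graphs -/

/-- `enforcerForces adj n A F` says that Enforcer, as last player, can within `n` rounds force
Avoider to have picked both ends of an edge, if Avoider has picked the vertices of `A`, the
vertices of `F` are free, and it is Avoider's turn. -/
def enforcerForces {α : Type*} [DecidableEq α] (adj : α → α → Bool) :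
    ℕ → List α → List α → Bool
  | 0, _, _ => false
  -- Without the test on `F`, `all` would hold vacuously in a finished game that Avoider has won.
  | n + 1, A, F => !F.isEmpty && F.all fun x => A.any (adj x) ||
      (F.erase x).any fun y => enforcerForces adj n (x :: A) ((F.erase x).erase y)

/-- Soundness of the search. Since only this direction is needed, `adj` may be any Boolean relation
that implies adjacency, chosen so that it evaluates well. -/
theorem not_avoiderWinsFrom_of_enforcerForces {W : Type*} [Fintype W] [DecidableEq W]
    {H : SimpleGraph W} {adj : W → W → Bool} (hadj : ∀ u v, adj u v = true → H.Adj u v) (n : ℕ) :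
    ∀ (A F : List W) (E : Finset W), F.Nodup →
      (∀ v, v ∈ F ↔ v ∉ A.toFinset ∪ E) → enforcerForces adj n A F = true →
      ¬ AvoiderWinsFrom (graphEdges H) .avoider A.toFinset E := by
  induction n with
  | zero => intro A F E _ _ h; simp [enforcerForces] at h
  | succ n ih =>
    intro A F E hnd hmem h hwin
    simp only [enforcerForces, Bool.and_eq_true, Bool.not_eq_true', List.isEmpty_eq_false_iff,
      List.all_eq_true, Bool.or_eq_true, List.any_eq_true] at h
    obtain ⟨hF, h⟩ := h
    obtain ⟨v, hv⟩ := List.exists_mem_of_ne_nil F hF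
    have hfree : A.toFinset ∪ E ≠ Finset.univ := fun hu =>
      (hmem v).1 hv (hu ▸ Finset.mem_univ v)
    obtain ⟨x, hx, hE⟩ := (avoiderWinsFrom_avoider_iff hfree).1 hwin
    have hxF := (hmem x).2 hx
    rcases h x hxF with ⟨u, hu, hxu⟩ | ⟨y, hy, hforce⟩
    · refine hE.not_subset {x, u} ⟨x, u, hadj _ _ hxu, rfl⟩ ?_
      simp [Finset.insert_subset_iff, hu]
    · have hyx := (hnd.mem_erase_iff.1 hy).1
      have hyF := (hnd.mem_erase_iff.1 hy).2
      have hyf : y ∉ insert x A.toFinset ∪ E := by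
        have := (hmem y).1 hyF
        simp only [Finset.mem_union, Finset.mem_insert] at this ⊢
        tauto
      have hwin' := hE.enforcer_move hyf
      rw [← List.toFinset_cons] at hwin'
      refine ih (x :: A) ((F.erase x).erase y) (insert y E) ((hnd.erase x).erase y) ?_
        hforce hwin'
      intro t
      rw [(hnd.erase x).mem_erase_iff, hnd.mem_erase_iff, hmem t]
      simp only [Finset.mem_union, Finset.mem_insert, List.toFinset_cons]
      tauto

/-- By hand: Enforcer answers an end by the other end of the same path, and a centre by an end of
the other path. Six vertices make three rounds. -/
theorem not_avoiderWinsFrom_twoP3 :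
    ¬ AvoiderWinsFrom (graphEdges twoP3) .avoider ∅ ∅ := by
  let adj : Fin 3 ⊕ Fin 3 → Fin 3 ⊕ Fin 3 → Bool := fun u v => match u, v with
    | .inl i, .inl j => decide (i.val + 1 = j.val ∨ j.val + 1 = i.val)
    | .inr i, .inr j => decide (i.val + 1 = j.val ∨ j.val + 1 = i.val)
    | _, _ => false
  have hadj : ∀ u v, adj u v = true → twoP3.Adj u v := by
    rintro (i | i) (j | j) h <;> simp_all [adj, twoP3, SimpleGraph.pathGraph_adj]
  exact not_avoiderWinsFrom_of_enforcerForces hadj 3 []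
    [.inl 0, .inl 1, .inl 2, .inr 0, .inr 1, .inr 2] ∅ (by decide)
    (by rintro (i | i) <;> fin_cases i <;> simp) (by decide +kernel)

/-- Enforcer takes the opposite vertex, which leaves only neighbours of Avoider's vertex. -/
theorem not_avoiderWinsFrom_cycleGraph_four :
    ¬ AvoiderWinsFrom (graphEdges (SimpleGraph.cycleGraph 4)) .avoider ∅ ∅ :=
  not_avoiderWinsFrom_of_enforcerForces
    (adj := fun u v => decide ((SimpleGraph.cycleGraph 4).Adj u v))
    (fun _ _ h => of_decide_eq_true h) 2 [] [0, 1, 2, 3] ∅ (by decide) (by decide)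
    (by decide +kernel)

/-- By hand: Enforcer first takes a pendent vertex at a triangle vertex that is neither Avoider's
vertex nor its neighbour along a pendent edge. -/
theorem not_avoiderWinsFrom_sunlet3 :
    ¬ AvoiderWinsFrom (graphEdges sunlet3) .avoider ∅ ∅ := by
  let l : List (Fin 6 × Fin 6) := [(0, 1), (1, 2), (0, 2), (0, 3), (1, 4), (2, 5)]
  let adj : Fin 6 → Fin 6 → Bool := fun u v => l.contains (u, v) || l.contains (v, u)
  have hadj : ∀ u v, adj u v = true → sunlet3.Adj u v := by
    simp only [sunlet3, SimpleGraph.fromEdgeSet_adj, Set.mem_insert_iff, Set.mem_singleton_iff]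
    decide
  exact not_avoiderWinsFrom_of_enforcerForces hadj 3 [] [0, 1, 2, 3, 4, 5] ∅ (by decide)
    (by decide) (by decide +kernel)


/-! ### Graphs without `2P₃`, `C₄` and 3-sunlets -/

/-- The vertices `a`, `b`, `c` form a path (in this order) in `G`. -/
def IsP3 {V : Type*} (G : SimpleGraph V) (a b c : V) : Prop :=
  G.Adj a b ∧ G.Adj b c ∧ a ≠ c

theorem twoP3_isContained {V : Type*} {G : SimpleGraph V} {a b c d e f : V}
    (h : IsP3 G a b c) (h' : IsP3 G d e f) (hd : a ≠ d ∧ a ≠ e ∧ a ≠ f)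
    (he : b ≠ d ∧ b ≠ e ∧ b ≠ f) (hf : c ≠ d ∧ c ≠ e ∧ c ≠ f) : twoP3.IsContained G := by
  obtain ⟨h1, h2, h3⟩ := h
  obtain ⟨h4, h5, h6⟩ := h'
  refine ⟨⟨⟨Sum.elim ![a, b, c] ![d, e, f], ?_⟩, ?_⟩⟩
  · rintro (i | i) (j | j) hij <;>
      simp only [twoP3, SimpleGraph.sum_adj, SimpleGraph.pathGraph_adj] at hij <;>
      fin_cases i <;> fin_cases j <;> simp_all [G.adj_comm]
  · rintro (i | i) (j | j) hij <;> fin_cases i <;> fin_cases j <;>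
      simp_all [h1.ne, h2.ne, h4.ne, h5.ne, h1.ne', h2.ne', h4.ne', h5.ne']

theorem cycleGraph_four_isContained {V : Type*} {G : SimpleGraph V} {a b c d : V}
    (hab : G.Adj a b) (hbc : G.Adj b c) (hcd : G.Adj c d) (hda : G.Adj d a) (hac : a ≠ c)
    (hbd : b ≠ d) : (SimpleGraph.cycleGraph 4).IsContained G := by
  refine ⟨⟨⟨![a, b, c, d], ?_⟩, ?_⟩⟩
  · intro i j hij
    have hcases : j = i + 1 ∨ i = j + 1 := by
      revert i j
      decide
    have hsucc : ∀ k, G.Adj (![a, b, c, d] k) (![a, b, c, d] (k + 1)) := by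
      intro k
      fin_cases k
      exacts [hab, hbc, hcd, hda]
    rcases hcases with rfl | rfl
    exacts [hsucc i, (hsucc j).symm]
  · intro i j hij
    have := hab.ne; have := hbc.ne; have := hcd.ne; have := hda.ne
    fin_cases i <;> fin_cases j <;> simp_all

theorem sunlet3_isContained {V : Type*} {G : SimpleGraph V} {a b c u v w : V}
    (hab : G.Adj a b) (hbc : G.Adj b c) (hca : G.Adj c a) (hau : G.Adj a u) (hbv : G.Adj b v)
    (hcw : G.Adj c w) (hu : u ≠ b ∧ u ≠ c) (hv : v ≠ a ∧ v ≠ c) (hw : w ≠ a ∧ w ≠ b)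
    (huv : u ≠ v) (hvw : v ≠ w) (hwu : w ≠ u) : sunlet3.IsContained G := by
  refine ⟨⟨⟨![a, b, c, u, v, w], ?_⟩, ?_⟩⟩
  · intro i j hij
    simp only [sunlet3, SimpleGraph.fromEdgeSet_adj, Set.mem_insert_iff, Set.mem_singleton_iff]
      at hij
    revert hij
    fin_cases i <;> fin_cases j <;> simp [*, hab.symm, hbc.symm, hca.symm, hau.symm, hbv.symm,
      hcw.symm]
  · intro i j hij
    have := hab.ne; have := hbc.ne; have := hca.ne; have := hau.ne; have := hbv.ne
    have := hcw.ne
    fin_cases i <;> fin_cases j <;> simp_all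

/-- In a connected graph, a nonempty set of vertices that is closed under adjacency contains all
the vertices. -/
theorem mem_of_preconnected {W : Type*} {H : SimpleGraph W} (hH : H.Preconnected) {S : Set W}
    {a : W} (ha : a ∈ S) (hS : ∀ x ∈ S, ∀ y, H.Adj x y → y ∈ S) (w : W) : w ∈ S := by
  obtain ⟨p⟩ := hH a w
  induction p with
  | nil => exact ha
  | cons h p ih => exact ih (hS _ ha _ h)

/-! ### Connected graphs in which the paths on three vertices pairwise meet -/

section

variable {W : Type*} {H : SimpleGraph W}

/-- A triangle with pendent edges at two vertices is a bull in a connected graph without `2P₃`,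
`C₄` and 3-sunlets. -/
theorem bull_iso_of_triangle (hH : H.Preconnected)
    (h1 : ∀ a b c d e f, IsP3 H a b c → IsP3 H d e f →
      a = d ∨ a = e ∨ a = f ∨ b = d ∨ b = e ∨ b = f ∨ c = d ∨ c = e ∨ c = f)
    (h2 : ∀ a b c d, H.Adj a b → H.Adj b c → H.Adj c d → H.Adj d a → a = c ∨ b = d)
    (h3 : ¬ sunlet3.IsContained H) {a b c u v : W} (hab : H.Adj a b) (hbc : H.Adj b c)
    (hca : H.Adj c a) (hau : H.Adj a u) (hub : u ≠ b) (huc : u ≠ c) (hbv : H.Adj b v)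
    (hva : v ≠ a) (hvc : v ≠ c) : Nonempty (H ≃g bull) := by
  have s := fun {x y : W} (h : H.Adj x y) => h.symm
  have nab := hab.ne
  have nbc := hbc.ne
  have nca := hca.ne
  have nau := hau.ne
  have nbv := hbv.ne
  -- If `u = v`, or if there were any further edge between the five vertices, a 4-cycle would
  -- appear.
  have huv : u ≠ v := by
    rintro rfl
    have := h2 u a c b (s hau) (s hca) (s hbc) hbv
    grind
  have nub : ¬ H.Adj u b := fun h => by
    have := h2 u b c a h hbc hca hau
    grind
  have nuc : ¬ H.Adj u c := fun h => by
    have := h2 u c b a h (s hbc) (s hab) hau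
    grind
  have nva : ¬ H.Adj v a := fun h => by
    have := h2 v a c b h (s hca) (s hbc) hbv
    grind
  have nvc : ¬ H.Adj v c := fun h => by
    have := h2 v c a b h hca hab hbv
    grind
  have nuv : ¬ H.Adj u v := fun h => by
    have := h2 u v b a h (s hbv) (s hab) hau
    grind
  -- A sixth vertex adjacent to `c` would give a 3-sunlet; adjacent to another of the five vertices,
  -- it would give two disjoint paths on three vertices.
  have hall : ∀ w, w ∈ ({a, b, c, u, v} : Set W) := by
    refine mem_of_preconnected hH (a := a) (by simp) ?_
    simp only [Set.mem_insert_iff, Set.mem_singleton_iff]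
    rintro x (rfl | rfl | rfl | rfl | rfl) y hy <;> by_contra! hc
    · have := h1 u x y v b c ⟨s hau, hy, by grind⟩ ⟨s hbv, hbc, hvc⟩
      grind
    · have := h1 v x y u a c ⟨s hbv, hy, by grind⟩ ⟨s hau, s hca, huc⟩
      grind
    · exact h3 (sunlet3_isContained hab hbc hca hau hbv hy ⟨hub, huc⟩ ⟨hva, hvc⟩
        ⟨hc.1, hc.2.1⟩ huv (by grind) (by grind))
    · have := h1 y x a v b c ⟨s hy, s hau, by grind⟩ ⟨s hbv, hbc, hvc⟩
      grind
    · have := h1 y x b u a c ⟨s hy, s hbv, by grind⟩ ⟨s hau, s hca, huc⟩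
      grind
  have hbij : Function.Bijective ![a, b, c, u, v] := by
    constructor
    · intro i j hij
      fin_cases i <;> fin_cases j <;> simp_all
    · intro w
      rcases hall w with rfl | rfl | rfl | rfl | rfl
      exacts [⟨0, rfl⟩, ⟨1, rfl⟩, ⟨2, rfl⟩, ⟨3, rfl⟩, ⟨4, rfl⟩]
  refine ⟨RelIso.symm ⟨Equiv.ofBijective _ hbij, ?_⟩⟩
  intro i j
  have := s hab; have := s hbc; have := s hca; have := s hau; have := s hbv
  have : ¬ H.Adj b u := mt s nub
  have : ¬ H.Adj c u := mt s nuc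
  have : ¬ H.Adj a v := mt s nva
  have : ¬ H.Adj c v := mt s nvc
  have : ¬ H.Adj v u := mt s nuv
  simp only [bull, SimpleGraph.fromEdgeSet_adj, Set.mem_insert_iff, Set.mem_singleton_iff,
    Equiv.ofBijective_apply]
  fin_cases i <;> fin_cases j <;> simp [*]

/-- In a connected graph without `2P₃`, a cycle of length five without chords is everything. -/
theorem cycleGraph_five_iso (hH : H.Preconnected)
    (h1 : ∀ a b c d e f, IsP3 H a b c → IsP3 H d e f →
      a = d ∨ a = e ∨ a = f ∨ b = d ∨ b = e ∨ b = f ∨ c = d ∨ c = e ∨ c = f)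
    (htri : ∀ a b c, H.Adj a b → H.Adj b c → ¬ H.Adj c a) {f : Fin 5 → W}
    (hinj : Function.Injective f) (hf : ∀ i, H.Adj (f i) (f (i + 1))) :
    Nonempty (H ≃g SimpleGraph.cycleGraph 5) := by
  have s := fun {x y : W} (h : H.Adj x y) => h.symm
  have hstep : ∀ i k, H.Adj (f (i + k)) (f (i + (k + 1))) := fun i k => by
    rw [← add_assoc]
    exact hf (i + k)
  have hall : ∀ w, w ∈ Set.range f := by
    refine mem_of_preconnected hH (Set.mem_range_self 0) ?_
    rintro _ ⟨i, rfl⟩ y hy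
    by_contra hc
    have hc' : ∀ j, y ≠ f j := fun j h => hc ⟨j, h.symm⟩
    -- A neighbour `y` of `f i` outside the cycle starts a path disjoint from the one formed by the
    -- last three vertices. The index comparisons are then decided in `Fin 5`.
    have := h1 y (f i) (f (i + 1)) (f (i + 2)) (f (i + 3)) (f (i + 4))
      ⟨s hy, hf i, hc' _⟩ ⟨hstep i 2, hstep i 3,
        by rw [Ne, hinj.eq_iff]; simp⟩
    simp only [hc', hinj.eq_iff, false_or] at this
    revert this
    clear hc hc' hy
    revert i
    decide
  refine ⟨RelIso.symm ⟨Equiv.ofBijective f ⟨hinj, hall⟩, ?_⟩⟩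
  intro i j
  have hchord : ∀ k, ¬ H.Adj (f k) (f (k + 2)) := fun k h =>
    htri (f k) (f (k + 1)) (f (k + 2)) (hf k) (hstep k 1) (s h)
  have hcases : j = i ∨ j = i + 1 ∨ i = j + 1 ∨ j = i + 2 ∨ i = j + 2 := by
    revert i j; decide
  have hC : ∀ k : Fin 5, (SimpleGraph.cycleGraph 5).Adj k (k + 1) ∧
      ¬ (SimpleGraph.cycleGraph 5).Adj k (k + 2) := by decide
  change (H.Adj (f i) (f j)) ↔ _
  rcases hcases with rfl | rfl | rfl | rfl | rfl
  · simp
  · exact iff_of_true (hf i) (hC i).1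
  · exact iff_of_true (s (hf j)) (hC j).1.symm
  · exact iff_of_false (hchord i) (hC i).2
  · exact iff_of_false (mt s (hchord j)) (mt (fun h => h.symm) (hC j).2)

/-- The structure of the connected graphs without `2P₃`, `C₄` and 3-sunlets. -/
theorem iso_or_exists_hitting (hH : H.Preconnected)
    (h1 : ∀ a b c d e f, IsP3 H a b c → IsP3 H d e f →
      a = d ∨ a = e ∨ a = f ∨ b = d ∨ b = e ∨ b = f ∨ c = d ∨ c = e ∨ c = f)
    (h2 : ∀ a b c d, H.Adj a b → H.Adj b c → H.Adj c d → H.Adj d a → a = c ∨ b = d)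
    (h3 : ¬ sunlet3.IsContained H) {p q r : W} (hP : IsP3 H p q r) :
    Nonempty (H ≃g SimpleGraph.cycleGraph 5) ∨ Nonempty (H ≃g bull) ∨
      ∃ y, ∀ a b c, IsP3 H a b c → y = a ∨ y = b ∨ y = c := by
  by_contra! hcon
  obtain ⟨hC5, hbull, hmiss⟩ := hcon
  have s := fun {x y : W} (h : H.Adj x y) => h.symm
  have htri : ∀ a b c, H.Adj a b → H.Adj b c → ¬ H.Adj c a := by
    intro a b c hab hbc hca
    have nab := hab.ne
    have nbc := hbc.ne
    have nca := hca.ne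
    -- two of the vertices of the triangle cannot both have degree two
    have hout : ∀ a b c, H.Adj a b → H.Adj b c → H.Adj c a →
        (∃ v, H.Adj b v ∧ v ≠ a ∧ v ≠ c) ∨ ∃ w, H.Adj c w ∧ w ≠ a ∧ w ≠ b := by
      intro a b c hab hbc hca
      by_contra! hno
      obtain ⟨hb, hc⟩ := hno
      -- A path that misses `a` must meet the triangle in `b` or `c`, but away from `a` these two
      -- vertices would be joined only to each other.
      obtain ⟨x, y, z, hxyz, hx, hy, hz⟩ := hmiss a
      have := h1 a b c x y z ⟨hab, hbc, hca.ne'⟩ hxyz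
      obtain ⟨hxy, hyz, hxz⟩ := hxyz
      have := hb x; have := hb y; have := hb z
      have := hc x; have := hc y; have := hc z
      have := s hxy; have := s hyz
      grind
    rcases hout a b c hab hbc hca with ⟨v, hv⟩ | ⟨w, hw⟩
    · rcases hout b c a hbc hca hab with ⟨w, hw⟩ | ⟨u, hu⟩
      · exact hbull.false (bull_iso_of_triangle hH h1 h2 h3 hbc hca hab hv.1 hv.2.2 hv.2.1
          hw.1 hw.2.1 hw.2.2).some
      · exact hbull.false (bull_iso_of_triangle hH h1 h2 h3 hab hbc hca hu.1 hu.2.1 hu.2.2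
          hv.1 hv.2.1 hv.2.2).some
    · rcases hout c a b hca hab hbc with ⟨u, hu⟩ | ⟨v, hv⟩
      · exact hbull.false (bull_iso_of_triangle hH h1 h2 h3 hca hab hbc hw.1 hw.2.1 hw.2.2
          hu.1 hu.2.1 hu.2.2).some
      · exact hbull.false (bull_iso_of_triangle hH h1 h2 h3 hbc hca hab hv.1 hv.2.1 hv.2.2
          hw.1 hw.2.2 hw.2.1).some
  have hfive : ∀ a b c d e, H.Adj a b → H.Adj b c → H.Adj c d → H.Adj d e → H.Adj e a →
      a = c ∨ a = d ∨ b = d ∨ b = e ∨ c = e := by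
    intro a b c d e hab hbc hcd hde hea
    by_contra! hne
    have hinj : Function.Injective ![a, b, c, d, e] := by
      have := hab.ne; have := hbc.ne; have := hcd.ne; have := hde.ne; have := hea.ne
      intro i j hij
      fin_cases i <;> fin_cases j <;> simp_all
    refine hC5.false (cycleGraph_five_iso hH h1 htri hinj ?_).some
    intro i
    fin_cases i
    exacts [hab, hbc, hcd, hde, hea]
  -- there is no path on five vertices
  have hP5 : ∀ a b c d e, H.Adj a b → H.Adj b c → H.Adj c d → H.Adj d e →
      a = c ∨ a = d ∨ a = e ∨ b = d ∨ b = e ∨ c = e := by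
    intro a b c d e hab hbc hcd hde
    by_contra! hne
    obtain ⟨nac, nad, nae, nbd, nbe, nce⟩ := hne
    -- a path from `{a, b}` to `{d, e}` avoiding `c` leads to a contradiction
    have hcross : ∀ x y, (x = a ∨ x = b) → (y = d ∨ y = e) → ¬ H.Adj x y := by
      -- The edges `ad` and `be` close a 4-cycle, `ae` a 5-cycle and `bd` a triangle.
      rintro x y (rfl | rfl) (rfl | rfl) hxy
      · have := h2 x b c y hab hbc hcd (s hxy); grind
      · have := hfive x b c d y hab hbc hcd hde (s hxy); grind
      · exact htri x c y hbc hcd (s hxy)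
      · have := h2 x c d y hbc hcd hde (s hxy); grind
    have hcross2 : ∀ x y w, (x = a ∨ x = b) → (y = d ∨ y = e) → H.Adj x w → w ≠ c →
        ¬ H.Adj w y := by
      intro x y w hx hy hxw hwc hwy
      have wa : w ≠ a := fun h => hcross w y (Or.inl h) hy hwy
      have wb : w ≠ b := fun h => hcross w y (Or.inr h) hy hwy
      have wd : w ≠ d := fun h => hcross x w hx (Or.inl h) hxw
      have we : w ≠ e := fun h => hcross x w hx (Or.inr h) hxw
      -- Via `w`, going from `a` to `d` or from `b` to `e` closes a 5-cycle, and from `b` to `d` a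
      -- 4-cycle. From `a` to `e`, the paths `w a b` and `c d e` are disjoint.
      rcases hx with rfl | rfl <;> rcases hy with rfl | rfl
      · have := hfive x b c y w hab hbc hcd (s hwy) (s hxw); grind
      · have := h1 w x b c d y ⟨s hxw, hab, wb⟩ ⟨hcd, hde, nce⟩
        have := hab.ne; have := hbc.ne; grind
      · have := h2 x c y w hbc hcd (s hwy) (s hxw); grind
      · have := hfive x c d y w hbc hcd hde (s hwy) (s hxw); grind
    -- A path that misses `c` meets both `{a, b}` and `{d, e}`, so it joins them by an edge or
    -- through a middle vertex.
    obtain ⟨x, y, z, hxyz, hx, hy, hz⟩ := hmiss c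
    have e1 := h1 a b c x y z ⟨hab, hbc, nac⟩ hxyz
    have e2 := h1 c d e x y z ⟨hcd, hde, nce⟩ hxyz
    obtain ⟨hxy, hyz, hxz⟩ := hxyz
    have hyx := s hxy
    have hzy := s hyz
    have := hcross x y; have := hcross y x; have := hcross y z; have := hcross z y
    have := hcross2 x z y; have := hcross2 z x y
    have := hab.ne; have := hbc.ne; have := hcd.ne; have := hde.ne
    grind
  -- there is no path on four vertices
  have hP4 : ∀ a b c d, H.Adj a b → H.Adj b c → H.Adj c d → a = c ∨ b = d ∨ a = d := by
    intro a b c d hab hbc hcd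
    by_contra! hne
    obtain ⟨nac, nbd, nad⟩ := hne
    -- there is a star centred at the third vertex that avoids the second one
    have hstar : ∀ a b c d, H.Adj a b → H.Adj b c → H.Adj c d → a ≠ c → b ≠ d → a ≠ d →
        ∃ x x', H.Adj c x ∧ H.Adj c x' ∧ x ≠ x' ∧ x ≠ b ∧ x' ≠ b := by
      intro a b c d hab hbc hcd nac nbd nad
      -- A path that misses `b` contains `c`: otherwise it would join `a` to `d`, closing a 4-cycle
      -- or a 5-cycle. It cannot have `c` as an end (`hend`), since it would extend `a b c` to a
      -- path on five vertices or close a 4-cycle. So `c` is its centre.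
      obtain ⟨x, y, z, hxyz, hx, hy, hz⟩ := hmiss b
      have e1 := h1 a b c x y z ⟨hab, hbc, nac⟩ hxyz
      have e2 := h1 b c d x y z ⟨hbc, hcd, nbd⟩ hxyz
      obtain ⟨hxy, hyz, hxz⟩ := hxyz
      have hda : ¬ H.Adj d a := fun h => by
        have := h2 a b c d hab hbc hcd h; grind
      have had : ¬ H.Adj a d := mt s hda
      have hdwa : ∀ w, H.Adj d w → w ≠ b → w ≠ c → ¬ H.Adj w a := fun w hdw wb wc hwa => by
        have := hfive a b c d w hab hbc hcd hdw hwa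
        have := hwa.ne; have := hdw.ne; grind
      have hend : ∀ x x', H.Adj c x → H.Adj x x' → x ≠ b → x' ≠ b → c = x' := by
        intro x x' hcx hxx' xb x'b
        by_contra ncx'
        have n1 := htri a b c hab hbc
        have := hP5 a b c x x' hab hbc hcx hxx'
        have : x ≠ a := by rintro rfl; exact n1 hcx
        have : x' = a := by grind
        subst this
        have := h2 x' b c x hab hbc hcx hxx'
        grind
      have hca : ¬ H.Adj c a := htri a b c hab hbc
      have hyx := s hxy
      have hzy := s hyz
      by_cases hyc : y = c
      · subst hyc
        exact ⟨x, z, hyx, hyz, hxz, by grind, by grind⟩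
      · exfalso
        by_cases hxc : x = c
        · subst hxc
          exact hxz (hend y z hxy hyz (by grind) (by grind))
        · by_cases hzc : z = c
          · subst hzc
            exact hxz (hend y x hzy hyx (by grind) (by grind)).symm
          · have := hdwa y
            grind
    obtain ⟨x, x', hcx, hcx', hxx', hxb, hx'b⟩ := hstar a b c d hab hbc hcd nac nbd nad
    obtain ⟨z, z', hbz, hbz', hzz', hzc, hz'c⟩ :=
      hstar d c b a (s hcd) (s hbc) (s hab) nbd.symm nac.symm nad.symm
    -- The stars at `c` and `b` are disjoint, as a common leaf would form a triangle with the edge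
    -- `bc`.
    have := h1 x c x' z b z' ⟨s hcx, hcx', hxx'⟩ ⟨s hbz, hbz', hzz'⟩
    have := htri b c x hbc hcx; have := htri b c x' hbc hcx'
    have := s hbz; have := s hbz'
    have := hbc.ne
    grind
  obtain ⟨hpq, hqr, hpr⟩ := hP
  -- This path meets `p q r` in `p` or `r`, whose only neighbour is `q` (`hleaf`), yet it misses
  -- `q`.
  obtain ⟨x, y, z, hxyz, hx, hy, hz⟩ := hmiss q
  have e1 := h1 p q r x y z ⟨hpq, hqr, hpr⟩ hxyz
  obtain ⟨hxy, hyz, hxz⟩ := hxyz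
  have hleaf : ∀ a b c t, H.Adj a b → H.Adj b c → a ≠ c → H.Adj a t → b = t := by
    intro a b c t hab hbc hac hat
    by_contra hbt
    have := hP4 t a b c (s hat) hab hbc
    have : t = c := by grind
    subst this
    exact htri a b t hab hbc (s hat)
  have hp := fun t => hleaf p q r t hpq hqr hpr
  have hr := fun t => hleaf r q p t (s hqr) (s hpq) hpr.symm
  rcases e1 with rfl | rfl | rfl | h | h | h | rfl | rfl | rfl
  exacts [hy (hp _ hxy), hx (hp _ (s hxy)), hy (hp _ (s hyz)), hx h, hy h, hz h,
    hy (hr _ hxy), hx (hr _ (s hxy)), hy (hr _ (s hyz))]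

end


/-! ### Avoider's strategy -/

/-- An odd set of vertices that contains no path on three vertices has an isolated vertex. -/
theorem exists_isolated_of_odd {V : Type*} [DecidableEq V] {G : SimpleGraph V}
    {F : Finset V} (hodd : Odd F.card)
    (hF : ∀ a ∈ F, ∀ b ∈ F, ∀ c ∈ F, ¬ IsP3 G a b c) : ∃ x ∈ F, ∀ v ∈ F, ¬ G.Adj x v := by
  by_contra! hcon
  choose! g hg hadj using hcon
  -- Choosing a neighbour is a fixed-point-free involution, since `x`, `g x`, `g (g x)` is not a
  -- path on three vertices. So `F` has even cardinality.
  have hsum : ∑ x ∈ F, (1 : ZMod 2) = 0 := by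
    refine Finset.sum_involution (fun x _ => g x) (fun _ _ => by decide)
      (fun x hx _ => (hadj x hx).ne') (fun x hx => hg x hx) (fun x hx => ?_)
    by_contra hne
    exact hF x hx (g x) (hg x hx) (g (g x)) (hg _ (hg x hx))
      ⟨hadj x hx, hadj _ (hg x hx), fun h => hne h.symm⟩
  rw [Finset.sum_const, nsmul_one, ZMod.natCast_eq_zero_iff_even] at hsum
  exact Nat.not_even_iff_odd.2 hodd hsum

/-- A property of positions that implies that Avoider has not lost, that is preserved by the moves
of Enforcer and that Avoider can preserve at her turns gives a winning strategy. -/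
theorem avoiderWinsFrom_of_invariant {V : Type*} [Fintype V] [DecidableEq V] {G : SimpleGraph V}
    {P : Finset V → Finset V → Prop} (hindep : ∀ A E, P A E → ∀ u ∈ A, ∀ v ∈ A, ¬ G.Adj u v)
    (henf : ∀ A E z, z ∉ A ∪ E → P A E → P A (insert z E))
    (hav : ∀ A E, Even (A ∪ E)ᶜ.card → A ∪ E ≠ Finset.univ → P A E →
      ∃ x, x ∉ A ∪ E ∧ P (insert x A) E) (n : ℕ) :
    ∀ A E, (A ∪ E)ᶜ.card = n → Even n → P A E →
      AvoiderWinsFrom (graphEdges G) .avoider A E := by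
  induction n using Nat.strong_induction_on with
  | _ n ih =>
  intro A E hn heven hP
  by_cases hfull : A ∪ E = Finset.univ
  · refine .gameOver _ _ _ hfull ?_
    rintro e ⟨u, v, huv, rfl⟩ hs
    simp only [Finset.insert_subset_iff, Finset.singleton_subset_iff] at hs
    exact hindep A E hP u hs.1 v hs.2 huv
  obtain ⟨x, hx, hPx⟩ := hav A E (hn ▸ heven) hfull hP
  have h1 : (insert x A ∪ E)ᶜ.card + 1 = n := by
    rw [← hn, Finset.insert_union, Finset.compl_insert]
    exact Finset.card_erase_add_one (by simpa using hx)
  refine .avoiderMove _ _ x hx (.enforcerMove _ _ ?_ ?_)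
  · intro hu
    rw [hu] at h1
    simp only [Finset.compl_univ, Finset.card_empty, zero_add] at h1
    rw [← h1] at heven
    simp at heven
  · intro z hz
    have h2 : (insert x A ∪ insert z E)ᶜ.card + 1 = (insert x A ∪ E)ᶜ.card := by
      rw [Finset.union_insert, Finset.compl_insert]
      exact Finset.card_erase_add_one (by simpa using hz)
    refine ih _ (by omega) _ _ rfl ?_ (henf _ _ _ hz hPx)
    have h3 : n = (insert x A ∪ insert z E)ᶜ.card + 2 := by omega
    rw [h3] at heven
    simpa [Nat.even_add] using heven

/-- If the order is odd, `henf` absorbs Enforcer's opening move, and an even number of vertices is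
left for Avoider's turn. -/
theorem avoiderWinsAsSecondToLast_of_invariant {V : Type*} [Fintype V] [DecidableEq V]
    {G : SimpleGraph V} {P : Finset V → Finset V → Prop}
    (hindep : ∀ A E, P A E → ∀ u ∈ A, ∀ v ∈ A, ¬ G.Adj u v)
    (henf : ∀ A E z, z ∉ A ∪ E → P A E → P A (insert z E))
    (hav : ∀ A E, Even (A ∪ E)ᶜ.card → A ∪ E ≠ Finset.univ → P A E →
      ∃ x, x ∉ A ∪ E ∧ P (insert x A) E) (h0 : P ∅ ∅) :
    AvoiderWinsAsSecondToLast (graphEdges G) := by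
  unfold AvoiderWinsAsSecondToLast firstPlayer
  split_ifs with hodd
  · refine .enforcerMove _ _ ?_ ?_
    · obtain ⟨v⟩ : Nonempty V := Fintype.card_pos_iff.1 hodd.pos
      intro hu
      have := hu ▸ Finset.mem_univ v
      simp at this
    · intro z hz
      refine avoiderWinsFrom_of_invariant hindep henf hav _ _ _ rfl ?_ (henf _ _ _ hz h0)
      have : (∅ ∪ insert z ∅ : Finset V)ᶜ.card = Fintype.card V - 1 := by
        simp [Finset.card_compl]
      rw [this]
      exact Nat.Odd.sub_odd hodd odd_one
  · refine avoiderWinsFrom_of_invariant hindep henf hav _ _ _ rfl ?_ h0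
    simpa using Nat.not_odd_iff_even.1 hodd

/-- The positions in which all the paths on three free vertices pass through one vertex `y`, and
the other free vertices have no neighbour among the vertices picked by Avoider. -/
def IsStarSafe {V : Type*} [DecidableEq V] (G : SimpleGraph V) (A E : Finset V) : Prop :=
  (∀ u ∈ A, ∀ v ∈ A, ¬ G.Adj u v) ∧
    ∃ y ∉ A, (∀ u ∈ A, ∀ v ∉ A ∪ E, v ≠ y → ¬ G.Adj u v) ∧
      ∀ a ∉ A ∪ E, ∀ b ∉ A ∪ E, ∀ c ∉ A ∪ E, IsP3 G a b c → y = a ∨ y = b ∨ y = c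

/-- The positions with an untouched odd union `S` of components outside of which the free vertices
form a matching, and such that `S` becomes a pseudo-star whenever one of its vertices is picked. -/
def IsOddSafe {V : Type*} [DecidableEq V] (G : SimpleGraph V) (S A E : Finset V) : Prop :=
  (∀ u ∈ A, ∀ v ∈ A, ¬ G.Adj u v) ∧ (∀ u ∈ A, ∀ v ∉ A ∪ E, ¬ G.Adj u v) ∧ (∀ s ∈ S, s ∉ A ∪ E) ∧
    ∀ a ∉ A ∪ E, ∀ b ∉ A ∪ E, ∀ c ∉ A ∪ E, IsP3 G a b c → a ∈ S ∧ b ∈ S ∧ c ∈ S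

theorem IsStarSafe.insert_enforcer {V : Type*} [DecidableEq V] {G : SimpleGraph V}
    {A E : Finset V} (h : IsStarSafe G A E) (z : V) : IsStarSafe G A (insert z E) := by
  obtain ⟨h1, y, hy, h2, h3⟩ := h
  have hm : ∀ v, v ∉ A ∪ insert z E → v ∉ A ∪ E := by
    intro v
    simp only [Finset.mem_union, Finset.mem_insert]
    tauto
  exact ⟨h1, y, hy, fun u hu v hv => h2 u hu v (hm v hv),
    fun a ha b hb c hc => h3 a (hm a ha) b (hm b hb) c (hm c hc)⟩

/-- Avoider takes a vertex that is isolated among the free vertices other than `y`. It may be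
adjacent to `y`, which does no harm because `y` is never taken by her. -/
theorem IsStarSafe.exists_move {V : Type*} [Fintype V] [DecidableEq V] {G : SimpleGraph V}
    {A E : Finset V} (h : IsStarSafe G A E) (heven : Even (A ∪ E)ᶜ.card)
    (hfull : A ∪ E ≠ Finset.univ) : ∃ x, x ∉ A ∪ E ∧ IsStarSafe G (insert x A) E := by
  obtain ⟨h1, y, hy, h2, h3⟩ : (∀ u ∈ A, ∀ v ∈ A, ¬ G.Adj u v) ∧
    ∃ y ∉ A ∪ E, (∀ u ∈ A, ∀ v ∉ A ∪ E, v ≠ y → ¬ G.Adj u v) ∧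
      ∀ a ∉ A ∪ E, ∀ b ∉ A ∪ E, ∀ c ∉ A ∪ E, IsP3 G a b c → y = a ∨ y = b ∨ y = c := by
    obtain ⟨h1, y, hy, h2, h3⟩ := h
    -- If Enforcer has taken `y`, no path on three free vertices is left, and any free vertex can
    -- replace `y`.
    by_cases hyE : y ∈ A ∪ E
    · obtain ⟨v, hv⟩ : ∃ v, v ∉ A ∪ E := by
        by_contra! hc
        exact hfull (Finset.eq_univ_iff_forall.2 hc)
      refine ⟨h1, v, hv, fun u hu w hw _ => h2 u hu w hw (fun h => hw (h ▸ hyE)), ?_⟩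
      intro a ha b hb c hc habc
      rcases h3 a ha b hb c hc habc with rfl | rfl | rfl <;> contradiction
    · exact ⟨h1, y, hyE, h2, h3⟩
  have hyF : y ∈ (A ∪ E)ᶜ := by simpa using hy
  have hodd : Odd ((A ∪ E)ᶜ.erase y).card := by
    rw [← Finset.card_erase_add_one hyF, Nat.even_add_one, Nat.not_even_iff_odd] at heven
    exact heven
  obtain ⟨x, hx, hiso⟩ := exists_isolated_of_odd (G := G) hodd (by
    simp only [Finset.mem_erase, Finset.mem_compl]
    intro a ha b hb c hc habc
    have := h3 a ha.2 b hb.2 c hc.2 habc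
    grind)
  simp only [Finset.mem_erase, Finset.mem_compl] at hx hiso
  have hm : ∀ v, v ∉ insert x A ∪ E → v ∉ A ∪ E := by
    intro v
    simp only [Finset.mem_union, Finset.mem_insert]
    tauto
  have hxA : ∀ u ∈ A, ¬ G.Adj u x := fun u hu => h2 u hu x hx.2 hx.1
  refine ⟨x, hx.2, ?_, y, ?_, ?_, fun a ha b hb c hc =>
    h3 a (hm a ha) b (hm b hb) c (hm c hc)⟩
  · intro u hu v hv huv
    rcases Finset.mem_insert.1 hu with rfl | hu <;> rcases Finset.mem_insert.1 hv with rfl | hv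
    · exact huv.ne rfl
    · exact hxA v hv huv.symm
    · exact hxA u ‹u ∈ A› huv
    · exact h1 u hu v hv huv
  · simp only [Finset.mem_union, Finset.mem_insert] at hy ⊢
    grind
  · intro u hu v hv hvy
    rcases Finset.mem_insert.1 hu with rfl | hu
    · exact hiso v ⟨hvy, hm v hv⟩
    · exact h2 u hu v (hm v hv) hvy

/-- Once Enforcer enters `S` at `z`, the vertex that `hstar` pairs with `z` hits all the remaining
free paths. It is not Avoider's, as `S` was untouched. -/
theorem IsOddSafe.insert_enforcer {V : Type*} [DecidableEq V] {G : SimpleGraph V}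
    {S A E : Finset V} (h : IsOddSafe G S A E)
    (hstar : ∀ s ∈ S, ∃ y ∈ S, ∀ a ∈ S, ∀ b ∈ S, ∀ c ∈ S, IsP3 G a b c →
      (s = a ∨ s = b ∨ s = c) ∨ y = a ∨ y = b ∨ y = c) (z : V) :
    IsStarSafe G A (insert z E) ∨ IsOddSafe G S A (insert z E) := by
  obtain ⟨h1, h2, h3, h4⟩ := h
  have hm : ∀ v, v ∉ A ∪ insert z E → v ∉ A ∪ E ∧ v ≠ z := by
    intro v
    simp only [Finset.mem_union, Finset.mem_insert]
    tauto
  by_cases hz : z ∈ S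
  · left
    obtain ⟨y, hy, hyP⟩ := hstar z hz
    refine ⟨h1, y, fun h => h3 y hy (Finset.mem_union_left _ h),
      fun u hu v hv _ => h2 u hu v (hm v hv).1, ?_⟩
    intro a ha b hb c hc habc
    obtain ⟨haS, hbS, hcS⟩ := h4 a (hm a ha).1 b (hm b hb).1 c (hm c hc).1 habc
    have := hyP a haS b hbS c hcS habc
    have := (hm a ha).2; have := (hm b hb).2; have := (hm c hc).2
    grind
  · right
    refine ⟨h1, fun u hu v hv => h2 u hu v (hm v hv).1, fun s hs => ?_,
      fun a ha b hb c hc => h4 a (hm a ha).1 b (hm b hb).1 c (hm c hc).1⟩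
    have := h3 s hs
    simp only [Finset.mem_union, Finset.mem_insert] at this ⊢
    grind

/-- As `S` is odd and entirely free, an odd number of free vertices lies outside it. They contain no
path on three vertices, so one of them is isolated among them, and it has no neighbour in `S`. -/
theorem IsOddSafe.exists_move {V : Type*} [Fintype V] [DecidableEq V] {G : SimpleGraph V}
    {S A E : Finset V} (h : IsOddSafe G S A E) (hodd : Odd S.card)
    (hS : ∀ u ∈ S, ∀ v ∉ S, ¬ G.Adj u v) (heven : Even (A ∪ E)ᶜ.card) :
    ∃ x, x ∉ A ∪ E ∧ IsOddSafe G S (insert x A) E := by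
  obtain ⟨h1, h2, h3, h4⟩ := h
  have hcard : Odd ((A ∪ E)ᶜ \ S).card := by
    have hsub : S ⊆ (A ∪ E)ᶜ := fun s hs => by simpa using h3 s hs
    rw [← Finset.card_sdiff_add_card_eq_card hsub, Nat.even_add'] at heven
    exact heven.2 hodd
  obtain ⟨x, hx, hiso⟩ := exists_isolated_of_odd (G := G) hcard (by
    simp only [Finset.mem_sdiff, Finset.mem_compl]
    exact fun a ha b hb c hc habc => ha.2 (h4 a ha.1 b hb.1 c hc.1 habc).1)
  simp only [Finset.mem_sdiff, Finset.mem_compl] at hx hiso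
  have hm : ∀ v, v ∉ insert x A ∪ E → v ∉ A ∪ E := by
    intro v
    simp only [Finset.mem_union, Finset.mem_insert]
    tauto
  have hxA : ∀ u ∈ A, ¬ G.Adj u x := fun u hu => h2 u hu x hx.1
  refine ⟨x, hx.1, ?_, ?_, ?_, fun a ha b hb c hc => h4 a (hm a ha) b (hm b hb) c (hm c hc)⟩
  · intro u hu v hv huv
    rcases Finset.mem_insert.1 hu with rfl | hu <;> rcases Finset.mem_insert.1 hv with rfl | hv
    · exact huv.ne rfl
    · exact hxA v hv huv.symm
    · exact hxA u ‹u ∈ A› huv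
    · exact h1 u hu v hv huv
  · intro u hu v hv huv
    rcases Finset.mem_insert.1 hu with rfl | hu
    · by_cases hvS : v ∈ S
      · exact hS v hvS u hx.2 huv.symm
      · exact hiso v ⟨hm v hv, hvS⟩ huv
    · exact h2 u hu v (hm v hv) huv
  · intro s hs
    have := h3 s hs
    simp only [Finset.mem_union, Finset.mem_insert] at this ⊢
    grind

/-- Avoider wins as second-to-last player if a single vertex hits all the paths on three
vertices. -/
theorem avoiderWinsAsSecondToLast_of_hitting {V : Type*} [Fintype V] [DecidableEq V]
    {G : SimpleGraph V} (y : V) (hy : ∀ a b c, IsP3 G a b c → y = a ∨ y = b ∨ y = c) :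
    AvoiderWinsAsSecondToLast (graphEdges G) :=
  avoiderWinsAsSecondToLast_of_invariant (P := IsStarSafe G) (fun _ _ h => h.1)
    (fun _ _ z _ h => h.insert_enforcer z) (fun _ _ he hf h => h.exists_move he hf)
    ⟨by simp, y, by simp, by simp, fun a _ b _ c _ => hy a b c⟩

/-- Avoider wins as second-to-last player if all the paths on three vertices are in an odd union
of components, and each vertex of it can be completed to a pair that hits all of them. -/
theorem avoiderWinsAsSecondToLast_of_odd {V : Type*} [Fintype V] [DecidableEq V]
    {G : SimpleGraph V} (S : Finset V) (hodd : Odd S.card)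
    (hS : ∀ u ∈ S, ∀ v ∉ S, ¬ G.Adj u v) (hP3 : ∀ a b c, IsP3 G a b c → a ∈ S ∧ b ∈ S ∧ c ∈ S)
    (hstar : ∀ s ∈ S, ∃ y ∈ S, ∀ a ∈ S, ∀ b ∈ S, ∀ c ∈ S, IsP3 G a b c →
      (s = a ∨ s = b ∨ s = c) ∨ y = a ∨ y = b ∨ y = c) :
    AvoiderWinsAsSecondToLast (graphEdges G) := by
  refine avoiderWinsAsSecondToLast_of_invariant
    (P := fun A E => IsStarSafe G A E ∨ IsOddSafe G S A E) ?_ ?_ ?_ ?_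
  · rintro A E (h | h)
    exacts [h.1, h.1]
  · rintro A E z - (h | h)
    exacts [Or.inl (h.insert_enforcer z), h.insert_enforcer hstar z]
  · rintro A E he hf (h | h)
    · obtain ⟨x, hx, h⟩ := h.exists_move he hf
      exact ⟨x, hx, Or.inl h⟩
    · obtain ⟨x, hx, h⟩ := h.exists_move hodd hS he
      exact ⟨x, hx, Or.inr h⟩
  · exact Or.inr ⟨by simp, by simp, by simp, fun a _ b _ c _ => hP3 a b c⟩

/-! ### Components -/

/-- A connected graph without a path on three vertices has at most two vertices. -/
theorem card_le_two_of_forall_not_isP3 {W : Type*} {H : SimpleGraph W} (hH : H.Connected)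
    (h : ∀ a b c, ¬ IsP3 H a b c) : Nat.card W ≤ 2 := by
  obtain ⟨v⟩ := hH.nonempty
  obtain ⟨w, hw⟩ : ∃ w, ∀ x, x ∈ ({v, w} : Set W) := by
    by_cases hv : ∃ w, H.Adj v w
    · obtain ⟨w, hvw⟩ := hv
      refine ⟨w, mem_of_preconnected hH.preconnected (a := v) (by simp) ?_⟩
      simp only [Set.mem_insert_iff, Set.mem_singleton_iff]
      rintro x (rfl | rfl) y hxy
      · by_contra! hc
        exact h w x y ⟨hvw.symm, hxy, hc.2.symm⟩
      · by_contra! hc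
        exact h v x y ⟨hvw, hxy, hc.1.symm⟩
    · refine ⟨v, mem_of_preconnected hH.preconnected (a := v) (by simp) ?_⟩
      simp only [Set.mem_insert_iff, Set.mem_singleton_iff, or_self]
      rintro x rfl y hxy
      exact absurd ⟨y, hxy⟩ hv
  rw [← Set.ncard_univ, ← Set.eq_univ_iff_forall.2 hw]
  exact (Set.ncard_insert_le v {w}).trans (by simp)

theorem three_le_ncard {W : Type*} {H : SimpleGraph W} {a b c : W} (h : IsP3 H a b c)
    {S : Set W} (hS : S.Finite) (ha : a ∈ S) (hb : b ∈ S) (hc : c ∈ S) : 3 ≤ S.ncard := by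
  have : ({a, b, c} : Set W).ncard = 3 :=
    Set.ncard_eq_three.2 ⟨a, b, c, h.1.ne, h.2.2, h.2.1.ne, rfl⟩
  rw [← this]
  refine Set.ncard_le_ncard ?_ hS
  rintro x (rfl | rfl | rfl) <;> assumption

theorem isP1OrP2_iff {W : Type*} [Finite W] {H : SimpleGraph W} (hH : H.Connected) :
    IsP1OrP2 H ↔ Nat.card W ≤ 2 := by
  constructor
  · rintro (⟨⟨e⟩⟩ | ⟨⟨e⟩⟩)
    · simp [Nat.card_congr e.toEquiv]
    · simp [Nat.card_congr e.toEquiv]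
  · intro hcard
    have htop : H = ⊤ := by
      ext u v
      simp only [SimpleGraph.top_adj]
      refine ⟨fun h => h.ne, fun huv => ?_⟩
      by_contra hn
      have : v ∈ ({u} : Set W) := by
        refine mem_of_preconnected hH.preconnected (S := {u}) (a := u) rfl ?_ v
        rintro x rfl y hxy
        have hyv : y ≠ v := by rintro rfl; exact hn hxy
        have h3 : ({x, y, v} : Set W).ncard = 3 :=
          Set.ncard_eq_three.2 ⟨x, y, v, hxy.ne, huv, hyv, rfl⟩
        have := Set.ncard_le_ncard (Set.subset_univ ({x, y, v} : Set W)) Set.finite_univ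
        rw [Set.ncard_univ] at this
        omega
      exact huv (Set.mem_singleton_iff.1 this).symm
    subst htop
    have := hH.nonempty
    have hpos : 0 < Nat.card W := Nat.card_pos
    have hpath : ∀ n, n = 1 ∨ n = 2 → SimpleGraph.pathGraph n = ⊤ := by
      rintro n (rfl | rfl) <;> ext i j <;>
        simp only [SimpleGraph.pathGraph_adj, SimpleGraph.top_adj] <;> omega
    have hiso : ∀ n, n = 1 ∨ n = 2 → Nat.card W = n →
        Nonempty ((⊤ : SimpleGraph W) ≃g SimpleGraph.pathGraph n) := by
      intro n hn hW
      rw [hpath n hn]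
      exact ⟨SimpleGraph.Iso.completeGraph (Finite.equivFinOfCardEq hW)⟩
    obtain h1 | h2 : Nat.card W = 1 ∨ Nat.card W = 2 := by omega
    exacts [Or.inl (hiso 1 (Or.inl rfl) h1), Or.inr (hiso 2 (Or.inr rfl) h2)]

/-- A component has at most two vertices exactly if it contains no path on three vertices; this is
applied after the deletion of `y`. -/
theorem isPseudoStar_iff {W : Type*} [Finite W] {H : SimpleGraph W} (hH : H.Connected)
    (hcard : 3 ≤ Nat.card W) :
    IsPseudoStar H ↔ ∃ y, ∀ a b c, IsP3 H a b c → y = a ∨ y = b ∨ y = c := by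
  constructor
  · rintro ⟨-, -, y, hy⟩
    refine ⟨y, fun a b c habc => ?_⟩
    by_contra! hne
    obtain ⟨h1, h2, h3⟩ := habc
    let a' : ({y}ᶜ : Set W) := ⟨a, hne.1.symm⟩
    let b' : ({y}ᶜ : Set W) := ⟨b, hne.2.1.symm⟩
    let c' : ({y}ᶜ : Set W) := ⟨c, hne.2.2.symm⟩
    have hab : (H.induce ({y}ᶜ : Set W)).Adj a' b' := h1
    have hbc : (H.induce ({y}ᶜ : Set W)).Adj b' c' := h2
    have := three_le_ncard (S := ((H.induce ({y}ᶜ : Set W)).connectedComponentMk b').supp)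
      ⟨hab, hbc, fun h => h3 (congrArg Subtype.val h)⟩ (Set.toFinite _)
      (SimpleGraph.ConnectedComponent.sound hab.reachable) rfl
      (SimpleGraph.ConnectedComponent.sound hbc.symm.reachable)
    have := hy ((H.induce ({y}ᶜ : Set W)).connectedComponentMk b')
    omega
  · rintro ⟨y, hy⟩
    refine ⟨hH, hcard, y, fun K => ?_⟩
    have hle : K.supp.ncard ≤ 2 := by
      refine card_le_two_of_forall_not_isP3 (H := K.toSimpleGraph) K.connected_toSimpleGraph ?_
      rintro ⟨a, ha⟩ ⟨b, hb⟩ ⟨c, hc⟩ ⟨h1, h2, h3⟩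
      have := hy a.1 b.1 c.1 ⟨h1, h2, fun h => h3 (Subtype.ext (Subtype.ext h))⟩
      rcases this with h | h | h
      exacts [a.2 h.symm, b.2 h.symm, c.2 h.symm]
    have hpos : 0 < K.supp.ncard := (Set.ncard_pos (Set.toFinite _)).2 K.nonempty_supp
    omega

/-- This form makes adjacency in the bull decidable by evaluation, for the check in
`exists_hitting_of_iso`. -/
theorem bull_adj (a b : Fin 5) : bull.Adj a b ↔
    (a, b) ∈ [((0 : Fin 5), (1 : Fin 5)), (1, 2), (0, 2), (0, 3), (1, 4)] ∨
      (b, a) ∈ [((0 : Fin 5), (1 : Fin 5)), (1, 2), (0, 2), (0, 3), (1, 4)] := by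
  revert a b
  simp only [bull, SimpleGraph.fromEdgeSet_adj, Set.mem_insert_iff, Set.mem_singleton_iff]
  decide

instance : DecidableRel bull.Adj := fun a b => decidable_of_iff _ (bull_adj a b).symm

/-- Each vertex of `C₅` or of the bull can be completed to a pair that hits all the paths on three
vertices. -/
theorem exists_hitting_of_iso {W : Type*} {H : SimpleGraph W}
    (h : Nonempty (H ≃g SimpleGraph.cycleGraph 5) ∨ Nonempty (H ≃g bull)) (s : W) :
    ∃ y, ∀ a b c, IsP3 H a b c → (s = a ∨ s = b ∨ s = c) ∨ y = a ∨ y = b ∨ y = c := by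
  have transfer : ∀ B : SimpleGraph (Fin 5), Nonempty (H ≃g B) →
      (∀ s : Fin 5, ∃ y, ∀ a b c, B.Adj a b → B.Adj b c → a ≠ c →
        (s = a ∨ s = b ∨ s = c) ∨ y = a ∨ y = b ∨ y = c) →
      ∃ y, ∀ a b c, IsP3 H a b c → (s = a ∨ s = b ∨ s = c) ∨ y = a ∨ y = b ∨ y = c := by
    rintro B ⟨e⟩ hB
    obtain ⟨y, hy⟩ := hB (e s)
    refine ⟨e.symm y, fun a b c ⟨h1, h2, h3⟩ => ?_⟩
    have := hy (e a) (e b) (e c) (e.map_adj_iff.2 h1) (e.map_adj_iff.2 h2)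
      (fun h => h3 (e.injective h))
    simpa only [EmbeddingLike.apply_eq_iff_eq, RelIso.symm_apply_eq] using this
  rcases h with h | h
  · exact transfer _ h (by decide +kernel)
  · exact transfer _ h (by decide +kernel)

theorem IsP3.mem_component {V : Type*} {G : SimpleGraph V} {a b c : V} (h : IsP3 G a b c) :
    a ∈ G.connectedComponentMk b ∧ b ∈ G.connectedComponentMk b ∧
      c ∈ G.connectedComponentMk b :=
  ⟨SimpleGraph.ConnectedComponent.sound h.1.reachable, rfl,
    SimpleGraph.ConnectedComponent.sound h.2.1.symm.reachable⟩

/-- A path on three vertices is in a component with at least three vertices. -/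
theorem IsP3.not_isP1OrP2 {V : Type*} [Finite V] {G : SimpleGraph V} {a b c : V}
    (h : IsP3 G a b c) : ¬ IsP1OrP2 (G.connectedComponentMk b).toSimpleGraph := by
  rw [isP1OrP2_iff (G.connectedComponentMk b).connected_toSimpleGraph]
  obtain ⟨ha, hb, hc⟩ := h.mem_component
  have := three_le_ncard h (S := (G.connectedComponentMk b).supp) (Set.toFinite _) ha hb hc
  have heq : Nat.card (G.connectedComponentMk b) = (G.connectedComponentMk b).supp.ncard := rfl
  omega

theorem exists_isP3_of_not_isP1OrP2 {W : Type*} [Finite W] {H : SimpleGraph W}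
    (hH : H.Connected) (h : ¬ IsP1OrP2 H) : 3 ≤ Nat.card W ∧ ∃ a b c, IsP3 H a b c := by
  rw [isP1OrP2_iff hH] at h
  refine ⟨by omega, ?_⟩
  by_contra! hc
  exact h (card_le_two_of_forall_not_isP3 hH hc)

theorem toSimpleGraph_isContained {V : Type*} {G : SimpleGraph V} (C : G.ConnectedComponent) :
    C.toSimpleGraph.IsContained G :=
  ⟨⟨C.toSimpleGraph_hom, Subtype.val_injective⟩⟩

/-- The components of a graph without `2P₃`, `C₄` and 3-sunlets. -/
theorem components_of_free {V : Type*} [Finite V] {G : SimpleGraph V}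
    (h1 : ¬ twoP3.IsContained G) (h2 : ¬ (SimpleGraph.cycleGraph 4).IsContained G)
    (h3 : ¬ sunlet3.IsContained G) :
    (∀ C : G.ConnectedComponent, IsP1OrP2 C.toSimpleGraph ∨
        IsC5OrBullOrPseudoStar C.toSimpleGraph) ∧
      ∀ C D : G.ConnectedComponent, ¬ IsP1OrP2 C.toSimpleGraph →
        ¬ IsP1OrP2 D.toSimpleGraph → C = D := by
  constructor
  · intro C
    by_cases hC : IsP1OrP2 C.toSimpleGraph
    · exact Or.inl hC
    refine Or.inr ?_
    have hconn := C.connected_toSimpleGraph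
    obtain ⟨hcard, p, q, r, hP⟩ := exists_isP3_of_not_isP1OrP2 hconn hC
    have g1 : ¬ twoP3.IsContained C.toSimpleGraph :=
      fun h => h1 (h.trans (toSimpleGraph_isContained C))
    have g2 : ¬ (SimpleGraph.cycleGraph 4).IsContained C.toSimpleGraph :=
      fun h => h2 (h.trans (toSimpleGraph_isContained C))
    have g3 : ¬ sunlet3.IsContained C.toSimpleGraph :=
      fun h => h3 (h.trans (toSimpleGraph_isContained C))
    have := iso_or_exists_hitting hconn.preconnected ?_ ?_ g3 hP
    · rwa [← isPseudoStar_iff hconn hcard] at this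
    · intro a b c d e f habc hdef
      by_contra! hne
      exact g1 (twoP3_isContained habc hdef (by tauto) (by tauto) (by tauto))
    · intro a b c d hab hbc hcd hda
      by_contra! hne
      exact g2 (cycleGraph_four_isContained hab hbc hcd hda hne.1 hne.2)
  · intro C D hC hD
    by_contra hCD
    obtain ⟨-, a, b, c, k1, k2, k3⟩ := exists_isP3_of_not_isP1OrP2 C.connected_toSimpleGraph hC
    obtain ⟨-, d, e, f, l1, l2, l3⟩ := exists_isP3_of_not_isP1OrP2 D.connected_toSimpleGraph hD
    have hne : ∀ (x : C) (y : D), x.1 ≠ y.1 := by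
      rintro ⟨x, hx⟩ ⟨y, hy⟩ rfl
      exact hCD (hx.symm.trans hy)
    exact h1 (twoP3_isContained (G := G) (a := a.1) (b := b.1) (c := c.1) (d := d.1) (e := e.1)
      (f := f.1) ⟨k1, k2, fun h => k3 (Subtype.ext h)⟩ ⟨l1, l2, fun h => l3 (Subtype.ext h)⟩
      ⟨hne _ _, hne _ _, hne _ _⟩ ⟨hne _ _, hne _ _, hne _ _⟩ ⟨hne _ _, hne _ _, hne _ _⟩)

/-- Avoider wins on the graphs with the components described in the theorem. -/
theorem avoiderWinsAsSecondToLast_of_components {V : Type*} [Fintype V] [DecidableEq V]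
    {G : SimpleGraph V}
    (h1 : ∀ C : G.ConnectedComponent, IsP1OrP2 C.toSimpleGraph ∨
        IsC5OrBullOrPseudoStar C.toSimpleGraph)
    (h2 : ∀ C D : G.ConnectedComponent, ¬ IsP1OrP2 C.toSimpleGraph →
        ¬ IsP1OrP2 D.toSimpleGraph → C = D) :
    AvoiderWinsAsSecondToLast (graphEdges G) := by
  classical
  by_cases hall : ∀ C : G.ConnectedComponent, IsP1OrP2 C.toSimpleGraph
  -- The empty graph is separate because it offers no vertex as hitting vertex; otherwise there are
  -- no paths to hit and any vertex will do.
  · rcases isEmpty_or_nonempty V with hV | ⟨⟨y⟩⟩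
    · have : firstPlayer V .enforcer = .avoider := by simp [firstPlayer, Player.opponent]
      rw [AvoiderWinsAsSecondToLast, this]
      exact .gameOver _ _ _ (Finset.eq_univ_of_forall fun v => hV.elim v)
        fun e ⟨u, _⟩ => hV.elim u
    · exact avoiderWinsAsSecondToLast_of_hitting y
        fun a b c h => absurd (hall _) h.not_isP1OrP2
  push Not at hall
  obtain ⟨C, hC⟩ := hall
  have hmem : ∀ a b c, IsP3 G a b c → a ∈ C ∧ b ∈ C ∧ c ∈ C := by
    intro a b c h
    rw [h2 C _ hC h.not_isP1OrP2]
    exact h.mem_component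
  have hconn := C.connected_toSimpleGraph
  have hlift : ∀ a b c (ha : a ∈ C) (hb : b ∈ C) (hc : c ∈ C), IsP3 G a b c →
      IsP3 C.toSimpleGraph ⟨a, ha⟩ ⟨b, hb⟩ ⟨c, hc⟩ := fun a b c ha hb hc ⟨k1, k2, k3⟩ =>
    ⟨k1, k2, fun h => k3 (congrArg Subtype.val h)⟩
  have hodd : Nonempty (C.toSimpleGraph ≃g SimpleGraph.cycleGraph 5) ∨
      Nonempty (C.toSimpleGraph ≃g bull) → AvoiderWinsAsSecondToLast (graphEdges G) := by
    intro h
    have hcard : Nat.card C = 5 := by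
      rcases h with ⟨⟨e⟩⟩ | ⟨⟨e⟩⟩ <;> exact (Nat.card_congr e.toEquiv).trans (by simp)
    refine avoiderWinsAsSecondToLast_of_odd (Finset.univ.filter (· ∈ C)) ?_ ?_ ?_ ?_
    · rw [← Fintype.card_subtype, ← Nat.card_eq_fintype_card]
      exact hcard ▸ (by decide : Odd 5)
    · simp only [Finset.mem_filter, Finset.mem_univ, true_and]
      intro u hu v hv huv
      exact hv ((SimpleGraph.ConnectedComponent.sound huv.symm.reachable).trans hu)
    · simpa using hmem
    · simp only [Finset.mem_filter, Finset.mem_univ, true_and]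
      intro s hs
      obtain ⟨⟨y, hy⟩, hyP⟩ := exists_hitting_of_iso h ⟨s, hs⟩
      refine ⟨y, hy, fun a ha b hb c hc habc => ?_⟩
      simpa using hyP _ _ _ (hlift a b c ha hb hc habc)
  rcases (h1 C).resolve_left hC with h | h | h
  · exact hodd (Or.inl h)
  · exact hodd (Or.inr h)
  · obtain ⟨⟨y, hy⟩, hyP⟩ := (isPseudoStar_iff hconn
      (exists_isP3_of_not_isP1OrP2 hconn hC).1).1 h
    refine avoiderWinsAsSecondToLast_of_hitting y fun a b c habc => ?_
    obtain ⟨ha, hb, hc⟩ := hmem a b c habc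
    simpa using hyP _ _ _ (hlift a b c ha hb hc habc)

end AvoiderEnforcer

theorem mainTheorem4 {V : Type*} [Fintype V] [DecidableEq V] (G : SimpleGraph V) :
    List.TFAE [
      AvoiderEnforcer.AvoiderWinsAsSecondToLast (AvoiderEnforcer.graphEdges G),
      (∀ C : G.ConnectedComponent, AvoiderEnforcer.IsP1OrP2 C.toSimpleGraph ∨
          AvoiderEnforcer.IsC5OrBullOrPseudoStar C.toSimpleGraph) ∧
        (∀ C D : G.ConnectedComponent, ¬ AvoiderEnforcer.IsP1OrP2 C.toSimpleGraph →
          ¬ AvoiderEnforcer.IsP1OrP2 D.toSimpleGraph → C = D),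
      ¬ AvoiderEnforcer.twoP3.IsContained G ∧
        ¬ (SimpleGraph.cycleGraph 4).IsContained G ∧
        ¬ AvoiderEnforcer.sunlet3.IsContained G] := by
  tfae_have 1 → 3 := fun h =>
    ⟨fun hc => AvoiderEnforcer.not_avoiderWinsFrom_twoP3 (h.of_isContained hc (by decide)),
      fun hc => AvoiderEnforcer.not_avoiderWinsFrom_cycleGraph_four
        (h.of_isContained hc (by decide)),
      fun hc => AvoiderEnforcer.not_avoiderWinsFrom_sunlet3 (h.of_isContained hc (by decide))⟩
  tfae_have 3 → 2 := fun h => AvoiderEnforcer.components_of_free h.1 h.2.1 h.2.2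
  tfae_have 2 → 1 := fun h =>
    AvoiderEnforcer.avoiderWinsAsSecondToLast_of_components h.1 h.2
  tfae_finish
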